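/- Let $M$ be a loopless matroid on a finite ground set $E$, of rank $r$, let $\mathcal L$ be its lattice of flats (with minimum $\hat 0=\varnothing$ and maximum $\hat 1=E$), let $\mathcal G=\mathcal G_{\max}=\mathcal L\setminus\{\hat 0\}$ be the maximal building set, and let $\vartriangleleft$ be any total order on $E$. Definitions. A set $S\subseteq\mathcal G$ is nested if no antichain $A\subseteq S$ with $|A|\ge 2$ has its join in $\mathcal G$ (for $\mathcal G=\mathcal G_{\max}$ the nested sets are the chains of nonempty flats; $\hat 1$ is allowed as a member). For $S$ a maximal nested set and $G\in S$ put $J^G=\bigvee\{H\in S: H<G\}$ and $\lambda_S(G)=\min_{\vartriangleleft}\{e\in E: J^G\vee e=G\}$; the parent $p(G)$ is the smallest element of $S$ strictly above $G$, if there is one. An element $G\in S$ is a descent of $S$ if it has a parent and $\lambda_S(G)\vartriangleright\lambda_S(p(G))$; $\mathrm{Des}(S)$ is the set of descents. A descent is a bottom descent if it is minimal in $S$, and a double descent if it is not minimal in $S$ and all elements of $S$ whose parent it is are descents. $S$ is stable if it has no bottom descents and no double descents. For flats $F\le G$ with $G\setminus F=\{e_1\vartriangleleft\dots\vartriangleleft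 e_k\}$ let $C_{\vartriangleleft}(F,G)=\{F\}\cup\{\mathrm{cl}(F\cup\{e_1,\dots,e_i\}):1\le i\le k\}$. Let $V=\mathcal G\setminus(C_{\vartriangleleft}(\hat 0,\hat 1)\cup\{\text{flats of rank }1\})$ and $$\Gamma=\Gamma_{\vartriangleleft}(M,\mathcal G)=\{\mathrm{Des}(S): S \text{ a stable maximal nested set}\}.$$ A simplicial complex (not necessarily pure) of dimension $d$ is called balanced if its vertices can be colored with $d+1$ colors so that no face contains two distinct vertices of the same color. Theorem. $\Gamma$ is a simplicial complex with vertex set $V$, and it is balanced. More precisely, the largest faces of $\Gamma$ have $\max\left(0,\lfloor (r-1)/2\rfloor\right)$ elements, and the map $F\mapsto\lfloor \mathrm{rk}(F)/2\rfloor$ colors $V$ with colors in $\{1,\dots,\lfloor (r-1)/2\rfloor\}$ in such a way that no face of $\Gamma$ contains two distinct vertices of the same color. -/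

import Mathlib

/-! Flats, nested sets and simplicial complexes are represented as families of sets: a flat of
`M : Matroid α` is a `Set α`, a set of flats is a `Set (Set α)`, and a simplicial complex whose
vertices are flats is a `Set (Set (Set α))`. -/

section SimplicialComplexes

variable {ι : Type*}

/-- `Δ` is the set of faces of a (finite, nonempty) simplicial complex with vertex set `V`. The
empty face is a face, and every element of `V` is a vertex of the complex. -/
structure IsSimplicialComplexOn (V : Set ι) (Δ : Set (Set ι)) : Prop where
  finite : V.Finite
  nonempty : Δ.Nonempty
  subset : ∀ σ ∈ Δ, σ ⊆ V
  down_closed : ∀ σ ∈ Δ, ∀ τ, τ ⊆ σ → τ ∈ Δ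
  singleton_mem : ∀ v ∈ V, {v} ∈ Δ

/-- The largest number of vertices of a face of `Δ` is `n`, that is, `Δ` has dimension `n - 1`. -/
def HasMaxFaceCard (Δ : Set (Set ι)) (n : ℕ) : Prop :=
  IsGreatest (Set.encard '' Δ) (n : ℕ∞)

/-- `Δ`, of dimension `d` and with vertex set `V`, is balanced: its vertices can be colored with
`n = d + 1` colors such that no face has two distinct vertices of the same color. -/
def IsBalanced (V : Set ι) (Δ : Set (Set ι)) : Prop :=
  ∃ n : ℕ, HasMaxFaceCard Δ n ∧
    ∃ κ : V → Fin n, ∀ σ ∈ Δ, ∀ v w : V, (v : ι) ∈ σ → (w : ι) ∈ σ → κ v = κ w → v = w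

end SimplicialComplexes

namespace BuiltMatroid

variable {α : Type*}

/-- The rank of a set, as a natural number (used for finite matroids only). -/
noncomputable def rk (M : Matroid α) (F : Set α) : ℕ := (M.eRk F).toNat

/-- The smallest flat. -/
def bot (M : Matroid α) : Set α := M.closure ∅

/-- The join of a family of flats in the lattice of flats. -/
def join (M : Matroid α) (A : Set (Set α)) : Set α := M.closure (⋃₀ A)

/-- The atoms of the lattice of flats: the flats of rank one. -/
def atoms (M : Matroid α) : Set (Set α) := {F | M.IsFlat F ∧ M.eRk F = 1}

/-- The maximal building set: all flats but the smallest one. -/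
def maxBuildingSet (M : Matroid α) : Set (Set α) := {F | M.IsFlat F ∧ F ≠ bot M}

/-- `S ⊆ 𝒢` is nested if the join of an antichain with at least two elements contained in `S` never
belongs to `𝒢`. -/
def IsNested (M : Matroid α) (𝒢 S : Set (Set α)) : Prop :=
  S ⊆ 𝒢 ∧ ∀ A ⊆ S, IsAntichain (· ⊆ ·) A → A.Nontrivial → join M A ∉ 𝒢

/-- A nested set that is maximal under inclusion; the maximal elements of `𝒢` are allowed
as elements of nested sets. -/
def IsMaxNested (M : Matroid α) (𝒢 S : Set (Set α)) : Prop :=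
  Maximal (IsNested M 𝒢) S

/-- The bottom `J^G = ⋁ S_{< G}` of the local interval of `S` at `G`. -/
def localBot (M : Matroid α) (S : Set (Set α)) (G : Set α) : Set α :=
  join M {H | H ∈ S ∧ H ⊂ G}

/-- `P` is the parent of `G` in `S`: the smallest element of `S` strictly above `G`. -/
def IsParent (S : Set (Set α)) (G P : Set α) : Prop :=
  IsLeast {H | H ∈ S ∧ G ⊂ H} P

section Order

variable (M : Matroid α) [LinearOrder M.E]

/-- `e` is the label of `G` in `S`: the smallest element `e` of the ground set such that
`J^G ∨ e = G`. -/
def IsLabel (S : Set (Set α)) (G : Set α) (e : M.E) : Prop :=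
  IsLeast {e : M.E | M.closure (insert (e : α) (localBot M S G)) = G} e

/-- `G` is a descent of `S`: it has a parent in `S`, and the label of `G` is strictly larger than
the label of its parent. -/
def IsDescent (S : Set (Set α)) (G : Set α) : Prop :=
  G ∈ S ∧ ∃ P, IsParent S G P ∧ ∃ a b : M.E, IsLabel M S G a ∧ IsLabel M S P b ∧ b < a

/-- The descent set of `S`. -/
def Des (S : Set (Set α)) : Set (Set α) := {G | IsDescent M S G}

/-- A bottom descent is a descent that is a minimal element of `S`. -/
def IsBottomDescent (S : Set (Set α)) (G : Set α) : Prop :=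
  IsDescent M S G ∧ Minimal (· ∈ S) G

/-- A double descent is a descent that is not minimal in `S` and all of whose children are
descents. -/
def IsDoubleDescent (S : Set (Set α)) (G : Set α) : Prop :=
  IsDescent M S G ∧ ¬ Minimal (· ∈ S) G ∧ ∀ H ∈ S, IsParent S H G → IsDescent M S H

/-- A stable maximal nested set: one with neither bottom descents nor double descents. -/
def IsStableMaxNested (𝒢 S : Set (Set α)) : Prop :=
  IsMaxNested M 𝒢 S ∧ ∀ G, ¬ IsBottomDescent M S G ∧ ¬ IsDoubleDescent M S G

/-- The chain from `F` to `G` associated with the order: for `G \ F = {e₁ < ⋯ < eₖ}` it consists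
of `F` and the closures of the sets `F ∪ {e₁, …, eᵢ}`. -/
def orderChain (F G : Set α) : Set (Set α) :=
  insert F {H | ∃ e : M.E, (e : α) ∈ G \ F ∧
    H = M.closure (F ∪ {x | ∃ y : M.E, (y : α) = x ∧ x ∈ G \ F ∧ y ≤ e})}

/-- The vertex set of the `Γ`-complex: the elements of `𝒢` that are neither atoms nor members of
the chain from the smallest to the largest flat. -/
def gammaVertices (𝒢 : Set (Set α)) : Set (Set α) :=
  𝒢 \ (orderChain M (bot M) M.E ∪ atoms M)

/-- The `Γ`-complex: its faces are the descent sets of the stable maximal nested sets. -/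
def gammaComplex (𝒢 : Set (Set α)) : Set (Set (Set α)) :=
  {D | ∃ S, IsStableMaxNested M 𝒢 S ∧ Des M S = D}

end Order

end BuiltMatroid

/-! For the maximal building set, maximal nested sets are complete flags of nonempty flats, and the
label of `G` is the smallest element of `G` outside the preceding flat. Each flat has at most one
child, so stability says that descents have rank at least 2 and never have consecutive ranks.

The key is the intrinsic description of faces in `mem_gammaComplex_iff`. A descent `G` has a witness
`b`, the label of its parent: `b` lies outside `G` but in every larger descent, while the elements
of `G` below `b`, or in smaller descents, lie in the flat preceding `G` and do not span it.
Conversely, given a family `D` with these properties, sort the ground set by the smallest member of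
`D` containing an element, then by the given order. The closures of initial segments form a flag
whose descent set is exactly `D`.

The description passes to subfamilies, so faces are closed downwards; for one flat it says that the
flat is a vertex. Members of a face have ranks between 2 and `r - 1`, and two ranks with the same
half are equal or consecutive, so the coloring is injective on faces. This bounds their size, and
flats chosen near a greedy flag attain the bound. -/

namespace BuiltMatroid

/-! ### Ranks of flats and the structure of maximal nested sets -/

section MaximalChains

variable {α : Type*} {M : Matroid α} {S : Set (Set α)} {F G H K : Set α}

theorem coe_rk (M : Matroid α) [M.RankFinite] (F : Set α) : (rk M F : ℕ∞) = M.eRk F :=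
  ENat.natCast_toNat (Matroid.eRk_ne_top_iff.2 (M.isRkFinite_set F))

theorem rk_mono (M : Matroid α) [M.RankFinite] (h : F ⊆ G) : rk M F ≤ rk M G := by
  have := M.eRk_mono h
  rw [← coe_rk, ← coe_rk] at this
  exact_mod_cast this

theorem rk_closure (M : Matroid α) (F : Set α) : rk M (M.closure F) = rk M F := by
  simp [rk]

theorem rk_empty (M : Matroid α) : rk M ∅ = 0 := by
  simp [rk]

theorem rk_insert [M.RankFinite] (hF : M.IsFlat F) {e : α} (he : e ∈ M.E) (heF : e ∉ F) :
    rk M (insert e F) = rk M F + 1 := by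
  have := M.eRk_insert_eq_add_one (X := F) (e := e) ⟨he, by rwa [hF.closure]⟩
  rw [← coe_rk, ← coe_rk] at this
  exact_mod_cast this

theorem rk_lt_of_ssubset [M.RankFinite] (hF : M.IsFlat F) (hG : G ⊆ M.E) (h : F ⊂ G) :
    rk M F < rk M G := by
  obtain ⟨e, heG, heF⟩ := Set.exists_of_ssubset h
  have := rk_mono M (Set.insert_subset heG h.subset)
  rw [rk_insert hF (hG heG) heF] at this
  omega

theorem eq_of_subset_of_rk_le [M.RankFinite] (hF : M.IsFlat F) (hG : G ⊆ M.E) (h : F ⊆ G)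
    (hr : rk M G ≤ rk M F) : F = G := by
  by_contra hne
  exact absurd (rk_lt_of_ssubset hF hG (h.ssubset_of_ne hne)) (by omega)

theorem bot_eq_empty (M : Matroid α) [M.Loopless] : bot M = ∅ :=
  M.loops_eq_empty

theorem mem_maxBuildingSet [M.Loopless] :
    F ∈ maxBuildingSet M ↔ M.IsFlat F ∧ F.Nonempty := by
  rw [maxBuildingSet, bot_eq_empty, Set.mem_ofPred_eq, Set.nonempty_iff_ne_empty]

/-- The nested sets of the maximal building set are the chains of nonempty flats. -/
theorem isNested_maxBuildingSet_iff [M.Loopless] :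
    IsNested M (maxBuildingSet M) S ↔ S ⊆ maxBuildingSet M ∧ IsChain (· ⊆ ·) S := by
  refine and_congr_right fun hS ↦ ⟨fun h F hF G hG hne ↦ ?_, fun h A hAS hA hnt ↦ ?_⟩
  · by_contra! hFG
    -- Two incomparable members form an antichain; their join is a nonempty flat, hence in the
    -- building set.
    refine h {F, G} (Set.pair_subset hF hG) ?_ (Set.nontrivial_pair hne) ?_
    · rintro A (rfl | rfl) B (rfl | rfl) hAB
      exacts [absurd rfl hAB, hFG.1, hFG.2, absurd rfl hAB]
    · obtain ⟨hfl, x, hx⟩ := mem_maxBuildingSet.1 (hS hF)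
      exact mem_maxBuildingSet.2 ⟨M.isFlat_closure _, x, M.mem_closure_of_mem'
        (Set.mem_sUnion_of_mem hx (by simp)) (hfl.subset_ground hx)⟩
  · obtain ⟨F, hF, G, hG, hne⟩ := hnt
    rcases h (hAS hF) (hAS hG) hne with h | h
    exacts [(hA hF hG hne h).elim, (hA hG hF hne.symm h).elim]

namespace IsMaxNested

theorem isChain [M.Loopless] (h : IsMaxNested M (maxBuildingSet M) S) : IsChain (· ⊆ ·) S :=
  (isNested_maxBuildingSet_iff.1 h.1).2

theorem isFlat [M.Loopless] (h : IsMaxNested M (maxBuildingSet M) S) (hF : F ∈ S) : M.IsFlat F :=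
  (mem_maxBuildingSet.1 (h.1.1 hF)).1

theorem nonempty [M.Loopless] (h : IsMaxNested M (maxBuildingSet M) S) (hF : F ∈ S) :
    F.Nonempty :=
  (mem_maxBuildingSet.1 (h.1.1 hF)).2

theorem mem_of_comparable [M.Loopless] (h : IsMaxNested M (maxBuildingSet M) S) (hF : M.IsFlat F)
    (hne : F.Nonempty) (hc : ∀ G ∈ S, F ⊆ G ∨ G ⊆ F) : F ∈ S := by
  refine h.2 (isNested_maxBuildingSet_iff.2 ⟨Set.insert_subset (mem_maxBuildingSet.2 ⟨hF, hne⟩)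
    h.1.1, h.isChain.insert fun G hG _ ↦ hc G hG⟩) (Set.subset_insert F S) (Set.mem_insert F S)

theorem finite [M.Finite] (h : IsMaxNested M (maxBuildingSet M) S) : S.Finite :=
  M.ground_finite.finite_subsets.subset fun _ hF ↦ (h.1.1 hF).1.subset_ground

theorem ssubset_of_not_subset [M.Loopless] (h : IsMaxNested M (maxBuildingSet M) S)
    (hF : F ∈ S) (hG : G ∈ S) (hn : ¬ F ⊆ G) : G ⊂ F :=
  ⟨(h.isChain.total hF hG).resolve_left hn, hn⟩

end IsMaxNested

theorem isFlat_localBot : M.IsFlat (localBot M S G) := M.isFlat_closure _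

theorem subset_localBot [M.Loopless] (h : IsMaxNested M (maxBuildingSet M) S) (hH : H ∈ S)
    (hHG : H ⊂ G) : H ⊆ localBot M S G :=
  M.subset_closure_of_subset' (Set.subset_sUnion_of_mem (by exact ⟨hH, hHG⟩))
    (h.isFlat hH).subset_ground

/-- The join of a finite nonempty chain is its largest member; the empty join is `∅` because there
are no loops. -/
theorem localBot_eq_or [M.Finite] [M.Loopless] (h : IsMaxNested M (maxBuildingSet M) S)
    (G : Set α) : (localBot M S G = ∅ ∧ ∀ H ∈ S, ¬ H ⊂ G) ∨
      (localBot M S G ∈ S ∧ localBot M S G ⊂ G) := by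
  rcases Set.eq_empty_or_nonempty {H | H ∈ S ∧ H ⊂ G} with he | hne
  · refine .inl ⟨?_, fun H hH hHG ↦ he.subset (show H ∈ {H | H ∈ S ∧ H ⊂ G} from ⟨hH, hHG⟩)⟩
    rw [localBot, join, he, Set.sUnion_empty]
    exact bot_eq_empty M
  · obtain ⟨L, hL, hmax⟩ := (h.finite.subset fun _ ↦ And.left).exists_maximal hne
    have : localBot M S G = L := by
      refine (subset_localBot h hL.1 hL.2).antisymm' ?_
      rw [← (h.isFlat hL.1).closure]
      refine M.closure_subset_closure (Set.sUnion_subset fun H hH ↦ ?_)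
      exact (h.isChain.total hH.1 hL.1).elim id (hmax hH)
    exact .inr (this ▸ hL)

theorem localBot_ssubset [M.Finite] [M.Loopless] (h : IsMaxNested M (maxBuildingSet M) S)
    (hG : G ∈ S) : localBot M S G ⊂ G := by
  rcases localBot_eq_or h G with ⟨h0, -⟩ | h1
  · exact h0 ▸ (h.nonempty hG).empty_ssubset
  · exact h1.2

/-- A flat strictly in between would be comparable with all of `S`, hence in `S` by maximality,
hence inside `localBot M S G`. -/
theorem eq_of_localBot_ssubset [M.Finite] [M.Loopless] (h : IsMaxNested M (maxBuildingSet M) S)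
    (hG : G ∈ S) (hK : M.IsFlat K) (hLK : localBot M S G ⊂ K) (hKG : K ⊆ G) : K = G := by
  by_contra hne
  have hKS : K ∈ S := by
    refine h.mem_of_comparable hK (Set.nonempty_of_ssubset' hLK)
      fun H hH ↦ ?_
    by_cases hGH : G ⊆ H
    · exact .inl (hKG.trans hGH)
    · exact .inr ((subset_localBot h hH (h.ssubset_of_not_subset hG hH hGH)).trans hLK.subset)
  exact hLK.not_subset (subset_localBot h hKS (hKG.ssubset_of_ne hne))

theorem closure_insert_localBot [M.Finite] [M.Loopless]
    (h : IsMaxNested M (maxBuildingSet M) S) (hG : G ∈ S) {e : α} (he : e ∈ M.E) :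
    M.closure (insert e (localBot M S G)) = G ↔ e ∈ G ∧ e ∉ localBot M S G := by
  have hL : insert e (localBot M S G) ⊆ M.E :=
    Set.insert_subset he isFlat_localBot.subset_ground
  constructor
  · refine fun heq ↦ ⟨heq.subset (M.mem_closure_of_mem (Set.mem_insert _ _)), fun hm ↦ ?_⟩
    rw [Set.insert_eq_of_mem hm, isFlat_localBot.closure] at heq
    exact (localBot_ssubset h hG).ne heq
  · refine fun hm ↦ eq_of_localBot_ssubset h hG (M.isFlat_closure _) ⟨?_, fun hs ↦ hm.2 ?_⟩ ?_
    · exact (Set.subset_insert _ _).trans (M.subset_closure _)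
    · exact hs (M.mem_closure_of_mem (Set.mem_insert _ _))
    · exact (M.closure_subset_closure (Set.insert_subset hm.1 (localBot_ssubset h hG).subset)).trans_eq
        (h.isFlat hG).closure

theorem rk_eq_rk_localBot_add_one [M.Finite] [M.Loopless]
    (h : IsMaxNested M (maxBuildingSet M) S) (hG : G ∈ S) :
    rk M G = rk M (localBot M S G) + 1 := by
  obtain ⟨e, heG, heL⟩ := Set.exists_of_ssubset (localBot_ssubset h hG)
  have he := (h.isFlat hG).subset_ground heG
  rw [← rk_insert isFlat_localBot he heL, ← rk_closure M (insert _ _),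
    (closure_insert_localBot h hG he).2 ⟨heG, heL⟩]

theorem minimal_iff_localBot_eq_empty [M.Finite] [M.Loopless]
    (h : IsMaxNested M (maxBuildingSet M) S) (hG : G ∈ S) :
    Minimal (· ∈ S) G ↔ localBot M S G = ∅ := by
  rcases localBot_eq_or h G with ⟨h0, h1⟩ | h0
  · refine iff_of_true ⟨hG, fun H hH hHG ↦ ?_⟩ h0
    by_contra hn
    exact h1 H hH ⟨hHG, hn⟩
  · exact iff_of_false (fun hm ↦ h0.2.not_subset (hm.2 h0.1 h0.2.subset))
      (h.nonempty h0.1).ne_empty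

theorem isParent_localBot [M.Finite] [M.Loopless]
    (h : IsMaxNested M (maxBuildingSet M) S) (hG : G ∈ S) :
    IsParent S (localBot M S G) G := by
  refine ⟨⟨hG, localBot_ssubset h hG⟩, fun K hK ↦ ?_⟩
  by_contra hn
  exact hK.2.not_subset (subset_localBot h hK.1 (h.ssubset_of_not_subset hG hK.1 hn))

theorem eq_localBot_of_isParent [M.Finite] [M.Loopless]
    (h : IsMaxNested M (maxBuildingSet M) S) (hH : H ∈ S) (hP : IsParent S H G) :
    H = localBot M S G := by
  have hG := hP.1.1
  have hs := subset_localBot h hH hP.1.2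
  rcases localBot_eq_or h G with ⟨h0, h1⟩ | h0
  · exact (h1 H hH hP.1.2).elim
  · by_contra hne
    exact h0.2.not_subset (hP.2 ⟨h0.1, hs.ssubset_of_ne hne⟩)

theorem exists_isParent [M.Finite] [M.Loopless] (h : IsMaxNested M (maxBuildingSet M) S)
    (hK : K ∈ S) (hGK : G ⊂ K) : ∃ P, IsParent S G P := by
  obtain ⟨P, hP, hmin⟩ := (h.finite.subset fun _ ↦ And.left).exists_minimal
    (s := {H | H ∈ S ∧ G ⊂ H}) ⟨K, hK, hGK⟩
  exact ⟨P, hP, fun H hH ↦ (h.isChain.total hP.1 hH.1).elim id (hmin hH)⟩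

/-! ### Labels and the conditions satisfied by descent sets -/

variable [LinearOrder M.E]

theorem isLabel_iff [M.Finite] [M.Loopless] (h : IsMaxNested M (maxBuildingSet M) S)
    (hG : G ∈ S) {a : M.E} : IsLabel M S G a ↔ (a : α) ∈ G ∧ (a : α) ∉ localBot M S G ∧
      ∀ e : M.E, (e : α) ∈ G → (e : α) ∉ localBot M S G → a ≤ e := by
  have : {e : M.E | M.closure (insert (e : α) (localBot M S G)) = G} =
      {e : M.E | (e : α) ∈ G ∧ (e : α) ∉ localBot M S G} :=
    Set.ext fun e ↦ closure_insert_localBot h hG e.2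
  rw [IsLabel, this, IsLeast, Set.mem_ofPred_eq, and_assoc]
  simp only [lowerBounds, Set.mem_ofPred_eq, and_imp, Subtype.forall]

theorem exists_isLabel [M.Finite] [M.Loopless] (h : IsMaxNested M (maxBuildingSet M) S)
    (hG : G ∈ S) : ∃ a, IsLabel M S G a := by
  obtain ⟨e, heG, heL⟩ := Set.exists_of_ssubset (localBot_ssubset h hG)
  have := M.ground_finite.to_subtype
  obtain ⟨a, ha, hmin⟩ := (Set.toFinite {e : M.E | (e : α) ∈ G ∧ (e : α) ∉ localBot M S G}
    ).exists_minimal ⟨⟨e, (h.isFlat hG).subset_ground heG⟩, heG, heL⟩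
  refine ⟨a, (isLabel_iff h hG).2 ⟨ha.1, ha.2, fun e h1 h2 ↦ ?_⟩⟩
  exact (le_total a e).elim id (hmin ⟨h1, h2⟩)

/-- The families of flats that occur as descent sets of stable maximal nested sets: chains of
flats of rank at least two without members of consecutive ranks, such that every member `G` is
missing an element `b` that lies in all larger members, and `G` is not spanned by its
elements that are smaller than `b` or contained in a smaller member. -/
structure IsDescentFamily (M : Matroid α) [LinearOrder M.E] (D : Set (Set α)) : Prop where
  isFlat : ∀ G ∈ D, M.IsFlat G
  two_le_rk : ∀ G ∈ D, 2 ≤ rk M G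
  isChain : IsChain (· ⊆ ·) D
  rk_ne : ∀ G ∈ D, ∀ H ∈ D, rk M H ≠ rk M G + 1
  exists_notMem : ∀ G ∈ D, ∃ b : M.E, (b : α) ∉ G ∧ (∀ B ∈ D, G ⊂ B → (b : α) ∈ B) ∧
    ¬ G ⊆ M.closure {y | y ∈ G ∧ ((∃ e : M.E, e = y ∧ e < b) ∨ ∃ A ∈ D, A ⊂ G ∧ y ∈ A)}

/-- Passing to a subfamily keeps the same `b`: fewer larger members must contain it, and the set
that must not span `G` shrinks. This makes the complex closed downwards. -/
theorem IsDescentFamily.mono {C D : Set (Set α)} (h : IsDescentFamily M D) (hCD : C ⊆ D) :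
    IsDescentFamily M C where
  isFlat G hG := h.isFlat G (hCD hG)
  two_le_rk G hG := h.two_le_rk G (hCD hG)
  isChain := h.isChain.mono hCD
  rk_ne G hG H hH := h.rk_ne G (hCD hG) H (hCD hH)
  exists_notMem G hG := by
    obtain ⟨b, hbG, hb, hn⟩ := h.exists_notMem G (hCD hG)
    refine ⟨b, hbG, fun B hB ↦ hb B (hCD hB), fun hs ↦ hn (hs.trans (M.closure_subset_closure ?_))⟩
    exact fun y hy ↦ ⟨hy.1, hy.2.imp_right fun ⟨A, hA, hAy⟩ ↦ ⟨A, hCD hA, hAy⟩⟩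

theorem isDescentFamily_Des [M.Finite] [M.Loopless]
    (hS : IsStableMaxNested M (maxBuildingSet M) S) : IsDescentFamily M (Des M S) where
  isFlat G hG := hS.1.isFlat hG.1
  two_le_rk G hG := by
    have h1 := rk_eq_rk_localBot_add_one hS.1 hG.1
    rcases localBot_eq_or hS.1 G with h | h
    · exact ((hS.2 G).1 ⟨hG, (minimal_iff_localBot_eq_empty hS.1 hG.1).2 h.1⟩).elim
    · have := rk_eq_rk_localBot_add_one hS.1 h.1
      omega
  isChain := hS.1.isChain.mono fun _ ↦ And.left
  rk_ne G hG H hH hr := by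
    have h1 := rk_eq_rk_localBot_add_one hS.1 hH.1
    have hGH : G ⊂ H := hS.1.ssubset_of_not_subset hH.1 hG.1 fun hs ↦ by
      have := rk_mono M hs
      omega
    have hL : G = localBot M S H := eq_of_subset_of_rk_le (hS.1.isFlat hG.1)
      isFlat_localBot.subset_ground (subset_localBot hS.1 hG.1 hGH) (by omega)
    -- Consecutive ranks make `G` the only child of `H`, so `H` would be a double descent.
    refine (hS.2 H).2 ⟨hH, fun hm ↦ hGH.not_subset (hm.2 hG.1 hGH.subset), fun K hK hKH ↦ ?_⟩
    rw [eq_localBot_of_isParent hS.1 hK hKH, ← hL]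
    exact hG
  exists_notMem G hG := by
    obtain ⟨hGS, P, hP, a, b, ha, hb, hba⟩ := hG
    rw [isLabel_iff hS.1 hGS] at ha
    rw [isLabel_iff hS.1 hP.1.1, ← eq_localBot_of_isParent hS.1 hGS hP] at hb
    -- The witness is the label `b` of the parent. Since `b < a`, every element of `G` below `b` is
    -- below the label of `G`, hence in `localBot M S G`.
    refine ⟨b, hb.2.1, fun B hB hGB ↦ hP.2 ⟨hB.1, hGB⟩ hb.1, fun hs ↦
      (localBot_ssubset hS.1 hGS).not_subset (hs.trans ?_)⟩
    rw [← (isFlat_localBot (M := M) (S := S) (G := G)).closure]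
    refine M.closure_subset_closure ?_
    rintro y ⟨hyG, ⟨e, rfl, he⟩ | ⟨A, hA, hAG, hyA⟩⟩
    · by_contra hn
      exact absurd (ha.2.2 e hyG hn) (he.trans hba).not_ge
    · exact subset_localBot hS.1 hA.1 hAG hyA

end MaximalChains

end BuiltMatroid

namespace BuiltMatroid

/-! ### Maximal chains from linear orders on the ground set -/

section InitialFlats

variable {α : Type*} {M : Matroid α} {Λ : Type*} [LinearOrder Λ] {key : M.E → Λ}
  {G K : Set α} {x y : M.E}

/-- The elements of the ground set whose key is at most that of `x`. -/
def keySegment (key : M.E → Λ) (x : M.E) : Set α := Subtype.val '' {z | key z ≤ key x}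

/-- The closures of the initial segments of the ground set ordered by `key`. -/
def initialFlats (key : M.E → Λ) : Set (Set α) :=
  Set.range fun x ↦ M.closure (keySegment key x)

theorem mem_keySegment : (y : α) ∈ keySegment key x ↔ key y ≤ key x := by
  simp [keySegment]

theorem keySegment_subset_ground : keySegment key x ⊆ M.E := by
  rintro _ ⟨z, -, rfl⟩
  exact z.2

theorem keySegment_mono (h : key y ≤ key x) : keySegment key y ⊆ keySegment key x :=
  Set.image_mono fun _ hz ↦ le_trans hz h

theorem mem_closure_keySegment (h : key y ≤ key x) : (y : α) ∈ M.closure (keySegment key x) :=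
  M.mem_closure_of_mem (mem_keySegment.2 h) keySegment_subset_ground

theorem closure_keySegment_subset (hK : M.IsFlat K)
    (h : ∀ z, key z ≤ key x → (z : α) ∈ K) : M.closure (keySegment key x) ⊆ K := by
  refine (M.closure_subset_closure ?_).trans_eq hK.closure
  rintro _ ⟨z, hz, rfl⟩
  exact h z hz

theorem closure_keySegment_mem : M.closure (keySegment key x) ∈ initialFlats key := ⟨x, rfl⟩

theorem isChain_initialFlats : IsChain (· ⊆ ·) (initialFlats key) := by
  rintro _ ⟨x, rfl⟩ _ ⟨y, rfl⟩ -
  exact (le_total (key x) (key y)).imp (fun h ↦ M.closure_subset_closure (keySegment_mono h))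
    (fun h ↦ M.closure_subset_closure (keySegment_mono h))

/-- Let `x` be the first element missing from `K`, and `V` the set of its predecessors. If some `e ∈
K` were not spanned by `V`, comparability would give `K ⊆ cl(V ∪ {x})`, and exchange would put `x`
in `cl(V ∪ {e}) ⊆ K`. -/
theorem mem_initialFlats_of_comparable [M.Finite] [M.Loopless] (hkey : key.Injective)
    (hK : M.IsFlat K) (hne : K.Nonempty) (hc : ∀ G ∈ initialFlats key, K ⊆ G ∨ G ⊆ K) :
    K ∈ initialFlats key := by
  have := M.ground_finite.to_subtype
  -- A down-set spanning `K` is nonempty, as `K` is nonempty and there are no loops; it is then the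
  -- segment of its last element.
  suffices ∃ V : Set M.E, K = M.closure (Subtype.val '' V) ∧ ∀ y ∈ V, ∀ z, key z ≤ key y → z ∈ V by
    obtain ⟨V, rfl, hV⟩ := this
    have hVne : V.Nonempty := by
      rw [Set.nonempty_iff_ne_empty]
      rintro rfl
      rw [Set.image_empty] at hne
      exact hne.ne_empty M.loops_eq_empty
    obtain ⟨y, hy, hmax⟩ := Set.exists_max_image V key V.toFinite hVne
    exact ⟨y, congrArg (fun V : Set M.E ↦ M.closure (Subtype.val '' V))
      (Set.ext fun z ↦ ⟨hV y hy z, hmax z⟩)⟩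
  rcases Set.eq_empty_or_nonempty {x : M.E | (x : α) ∉ K} with he | hx
  · refine ⟨Set.univ, ?_, fun _ _ _ _ ↦ trivial⟩
    rw [Set.image_univ, Subtype.range_coe, M.closure_ground]
    refine hK.subset_ground.antisymm fun e he' ↦ ?_
    by_contra hn
    exact he.subset (show (⟨e, he'⟩ : M.E) ∈ {x : M.E | (x : α) ∉ K} from hn)
  · obtain ⟨x, hxK, hmin⟩ := Set.exists_min_image _ key (Set.toFinite _) hx
    refine ⟨{z | key z < key x}, ?_, fun y hy z hz ↦ lt_of_le_of_lt hz hy⟩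
    have hVK : Subtype.val '' {z | key z < key x} ⊆ K := by
      rintro _ ⟨z, hz, rfl⟩
      by_contra hn
      exact (hmin z hn).not_gt hz
    refine Set.Subset.antisymm (fun e he ↦ ?_)
      ((M.closure_subset_closure hVK).trans_eq hK.closure)
    by_contra hn
    have hKx : K ⊆ M.closure (keySegment key x) :=
      (hc _ closure_keySegment_mem).resolve_right fun h ↦ hxK (h (mem_closure_keySegment le_rfl))
    have hseg : keySegment key x = insert (x : α) (Subtype.val '' {z | key z < key x}) := by
      rw [keySegment, ← Set.image_insert_eq]
      congr 1
      ext z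
      simp only [Set.mem_ofPred_eq, Set.mem_insert_iff, le_iff_eq_or_lt, hkey.eq_iff]
    rw [hseg] at hKx
    exact hxK ((M.closure_subset_closure (Set.insert_subset he hVK)).trans_eq hK.closure
      (Matroid.closure_exchange ⟨hKx he, hn⟩).1)

theorem isMaxNested_initialFlats [M.Finite] [M.Loopless] (hkey : key.Injective) :
    IsMaxNested M (maxBuildingSet M) (initialFlats key) := by
  refine ⟨isNested_maxBuildingSet_iff.2 ⟨?_, isChain_initialFlats⟩, fun T hT hST K hK ↦ ?_⟩
  · rintro _ ⟨x, rfl⟩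
    exact mem_maxBuildingSet.2 ⟨M.isFlat_closure _, x, mem_closure_keySegment le_rfl⟩
  · obtain ⟨hT1, hT2⟩ := isNested_maxBuildingSet_iff.1 hT
    obtain ⟨h1, h2⟩ := mem_maxBuildingSet.1 (hT1 hK)
    exact mem_initialFlats_of_comparable hkey h1 h2 fun G hG ↦ hT2.total hK (hST hG)

end InitialFlats

/-! ### Realizing a descent family by a stable maximal chain -/

section AdaptedChain

variable {α : Type*} {M : Matroid α} {D : Set (Set α)} {G : Set α}

/-- The number of members of `D` that miss `x`. -/
noncomputable def missCount (D : Set (Set α)) (x : α) : ℕ := {G | G ∈ D ∧ x ∉ G}.ncard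

theorem missCount_le_missCount (hD : D.Finite) {x y : α} (h : ∀ G ∈ D, x ∈ G → y ∈ G) :
    missCount D y ≤ missCount D x :=
  Set.ncard_le_ncard (fun G hG ↦ ⟨hG.1, fun hx ↦ hG.2 (h G hG.1 hx)⟩)
    (hD.subset fun _ ↦ And.left)

theorem exists_of_missCount_lt (hD : D.Finite) {x y : α} (h : missCount D x < missCount D y) :
    ∃ G ∈ D, x ∈ G ∧ y ∉ G := by
  by_contra! hn
  exact h.not_ge (missCount_le_missCount hD hn)

/-- If `x ∈ G` and `y ∉ G`, then in a chain every member missing `x` also misses `y`, and `G` misses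
only `y`. So `missCount` orders elements by the smallest member containing them. -/
theorem mem_of_missCount_le (hD : D.Finite) (hc : IsChain (· ⊆ ·) D) (hG : G ∈ D) {x y : α}
    (hx : x ∈ G) (h : missCount D y ≤ missCount D x) : y ∈ G := by
  by_contra hy
  refine h.not_gt (Set.ncard_lt_ncard ⟨fun H hH ↦ ⟨hH.1, fun hyH ↦ ?_⟩, fun hs ↦ ?_⟩
    (hD.subset fun _ ↦ And.left))
  · exact (hc.total hG hH.1).elim (fun h ↦ hH.2 (h hx)) (fun h ↦ hy (h hyH))
  · exact (hs (show G ∈ {G | G ∈ D ∧ y ∉ G} from ⟨hG, hy⟩)).2 hx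

variable [LinearOrder M.E]

/-- Orders the ground set by the smallest member of `D` that contains a given element, and then by
the given order. -/
noncomputable def adaptedKey (M : Matroid α) [LinearOrder M.E] (D : Set (Set α)) (x : M.E) :
    ℕ ×ₗ M.E :=
  toLex (missCount D x, x)

theorem adaptedKey_injective : (adaptedKey M D).Injective := fun _ _ h ↦
  congrArg (fun p ↦ (ofLex p).2) h

theorem adaptedKey_le {x y : M.E} : adaptedKey M D x ≤ adaptedKey M D y ↔
    missCount D (x : α) < missCount D (y : α) ∨
      missCount D (x : α) = missCount D (y : α) ∧ x ≤ y :=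
  Prod.Lex.toLex_le_toLex

theorem missCount_le_of_adaptedKey_le {x y : M.E} (h : adaptedKey M D x ≤ adaptedKey M D y) :
    missCount D (x : α) ≤ missCount D (y : α) :=
  (adaptedKey_le.1 h).elim le_of_lt fun h ↦ h.1.le

namespace IsDescentFamily

theorem finite [M.Finite] (h : IsDescentFamily M D) : D.Finite :=
  M.ground_finite.finite_subsets.subset fun G hG ↦ (h.isFlat G hG).subset_ground

theorem mem_of_adaptedKey_le [M.Finite] (h : IsDescentFamily M D) (hG : G ∈ D) {x y : M.E}
    (hx : (x : α) ∈ G) (hyx : adaptedKey M D y ≤ adaptedKey M D x) : (y : α) ∈ G :=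
  mem_of_missCount_le h.finite h.isChain hG hx (missCount_le_of_adaptedKey_le hyx)

theorem nonempty (h : IsDescentFamily M D) (hG : G ∈ D) : G.Nonempty := by
  rw [Set.nonempty_iff_ne_empty]
  rintro rfl
  have := h.two_le_rk _ hG
  rw [rk_empty] at this
  omega

/-- Each member of `D` is a down-set for the adapted key, hence comparable with every initial flat.
-/
theorem subset_initialFlats [M.Finite] [M.Loopless] (h : IsDescentFamily M D) :
    D ⊆ initialFlats (adaptedKey M D) := by
  refine fun G hG ↦ mem_initialFlats_of_comparable adaptedKey_injective (h.isFlat G hG)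
    (h.nonempty hG) ?_
  rintro _ ⟨z, rfl⟩
  by_cases hz : (z : α) ∈ G
  · exact .inr (closure_keySegment_subset (h.isFlat G hG) fun y ↦ h.mem_of_adaptedKey_le hG hz)
  · refine .inl fun y hy ↦ ?_
    let y' : M.E := ⟨y, (h.isFlat G hG).subset_ground hy⟩
    have : adaptedKey M D y' ≤ adaptedKey M D z :=
      (le_total _ _).resolve_right fun hzy ↦ hz (h.mem_of_adaptedKey_le (x := y') hG hy hzy)
    exact mem_closure_keySegment this

/-- At a flat outside `D` the chain moves to its parent within one block of elements with equal
`missCount`. There the key follows the given order, so the label cannot drop. -/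
theorem Des_initialFlats_subset [M.Finite] [M.Loopless] (h : IsDescentFamily M D) :
    Des M (initialFlats (adaptedKey M D)) ⊆ D := by
  have hS := isMaxNested_initialFlats (adaptedKey_injective (M := M) (D := D))
  rintro H ⟨hH, P, hP, a, b, ha, hb, hba⟩
  rw [isLabel_iff hS hH] at ha
  rw [isLabel_iff hS hP.1.1, ← eq_localBot_of_isParent hS hH hP] at hb
  by_contra hHD
  -- Some `w` in a segment spanning `H` is new in `H`; its own segment already spans `H`, since
  -- otherwise `w` would lie in a smaller member of the chain.
  obtain ⟨w, hwL, rfl⟩ : ∃ w : M.E, (w : α) ∉ localBot M (initialFlats (adaptedKey M D)) H ∧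
      M.closure (keySegment (adaptedKey M D) w) = H := by
    obtain ⟨z, rfl⟩ := id hH
    obtain ⟨w, hwz, hw⟩ : ∃ w : M.E, adaptedKey M D w ≤ adaptedKey M D z ∧
        (w : α) ∉ localBot M (initialFlats (adaptedKey M D))
          (M.closure (keySegment (adaptedKey M D) z)) := by
      by_contra! hn
      exact (localBot_ssubset hS hH).not_subset (closure_keySegment_subset isFlat_localBot hn)
    refine ⟨w, hw, ?_⟩
    by_contra hne
    exact hw (subset_localBot hS closure_keySegment_mem ((M.closure_subset_closure
      (keySegment_mono hwz)).ssubset_of_ne hne) (mem_closure_keySegment le_rfl))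
  have haw := ha.2.2 w (mem_closure_keySegment le_rfl) hwL
  have hwb : ¬ adaptedKey M D b ≤ adaptedKey M D w := fun hbw ↦
    hb.2.1 (mem_closure_keySegment hbw)
  rw [adaptedKey_le, not_or, not_and] at hwb
  rcases (not_lt.1 hwb.1).lt_or_eq with hlt | heq
  -- A member of `D` containing `w` but not `b` properly contains `H`, hence contains the parent `P`
  -- and with it `b`.
  · obtain ⟨G, hG, hwG, hbG⟩ := exists_of_missCount_lt h.finite hlt
    have hsub : M.closure (keySegment (adaptedKey M D) w) ⊆ G :=
      closure_keySegment_subset (h.isFlat G hG) fun y ↦ h.mem_of_adaptedKey_le hG hwG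
    refine hbG (hP.2 ⟨h.subset_initialFlats hG, hsub.ssubset_of_ne ?_⟩ hb.1)
    rintro rfl
    exact hHD hG
  · exact hwb.2 heq.symm (hba.le.trans haw)

/-- The witness `b` separates the labels: the label `p` of the parent is at most `b`, and the label
`a` of `G` exceeds `b`. -/
theorem subset_Des_initialFlats [M.Finite] [M.Loopless] (h : IsDescentFamily M D) :
    D ⊆ Des M (initialFlats (adaptedKey M D)) := by
  have hS := isMaxNested_initialFlats (adaptedKey_injective (M := M) (D := D))
  intro G hG
  have hGS := h.subset_initialFlats hG
  have hGfl := h.isFlat G hG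
  obtain ⟨b, hbG, hbB, hn⟩ := h.exists_notMem G hG
  obtain ⟨P, hP⟩ : ∃ P, IsParent (initialFlats (adaptedKey M D)) G P :=
    exists_isParent hS (closure_keySegment_mem (x := b)) (hS.ssubset_of_not_subset
      closure_keySegment_mem hGS fun hs ↦ hbG (hs (mem_closure_keySegment le_rfl)))
  obtain ⟨a, ha⟩ := exists_isLabel hS hGS
  obtain ⟨p, hp⟩ := exists_isLabel hS hP.1.1
  refine ⟨hGS, P, hP, a, p, ha, hp, ?_⟩
  rw [isLabel_iff hS hGS] at ha
  rw [isLabel_iff hS hP.1.1, ← eq_localBot_of_isParent hS hGS hP] at hp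
  have hpb : p ≤ b := by
    obtain ⟨z, rfl⟩ := hP.1.1
    by_cases hbz : adaptedKey M D b ≤ adaptedKey M D z
    -- Either `b` lies in `P` and competes for its label, or `z`, whose segment spans `P`, precedes
    -- `b`. In the latter case no member of `D` separates the two, since all members above `G`
    -- contain `b`; hence `z ≤ b`.
    · exact hp.2.2 b (mem_closure_keySegment hbz) hbG
    · have hzG : (z : α) ∉ G := fun hz ↦ hP.1.2.not_subset
        (closure_keySegment_subset hGfl fun y ↦ h.mem_of_adaptedKey_le hG hz)
      rcases adaptedKey_le.1 (not_le.1 hbz).le with hlt | heq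
      · obtain ⟨B, hB, hzB, hbB'⟩ := exists_of_missCount_lt h.finite hlt
        have hGB : G ⊆ B := (h.isChain.total hG hB).resolve_right fun hs ↦ hzG (hs hzB)
        exact (hbB' (hbB B hB ⟨hGB, fun hs ↦ hzG (hs hzB)⟩)).elim
      · exact (hp.2.2 z (mem_closure_keySegment le_rfl) hzG).trans heq.2
  -- If `a ≤ b`, the segment of `a` spans `G`, yet each of its elements is below `b` or in a smaller
  -- member of `D`.
  refine hpb.trans_lt (lt_of_not_ge fun hab ↦ hn ?_)
  have hab : a < b := hab.lt_of_ne (by rintro rfl; exact hbG ha.1)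
  have hsub : M.closure (keySegment (adaptedKey M D) a) ⊆
      M.closure {y | y ∈ G ∧ ((∃ e : M.E, e = y ∧ e < b) ∨ ∃ A ∈ D, A ⊂ G ∧ y ∈ A)} := by
    refine closure_keySegment_subset (M.isFlat_closure _) fun w hw ↦
      M.mem_closure_of_mem' ⟨h.mem_of_adaptedKey_le hG ha.1 hw, ?_⟩ w.2
    rcases adaptedKey_le.1 hw with hlt | heq
    · obtain ⟨A, hA, hwA, haA⟩ := exists_of_missCount_lt h.finite hlt
      exact .inr ⟨A, hA, ⟨(h.isChain.total hA hG).resolve_right fun hs ↦ haA (hs ha.1),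
        fun hs ↦ haA (hs ha.1)⟩, hwA⟩
    · exact .inl ⟨w, rfl, heq.2.trans_lt hab⟩
  refine Eq.subset (Eq.symm ?_) |>.trans hsub
  have haG : M.closure (keySegment (adaptedKey M D) a) ⊆ G :=
    closure_keySegment_subset hGfl fun y ↦ h.mem_of_adaptedKey_le hG ha.1
  by_contra hne
  exact ha.2.1 (subset_localBot hS closure_keySegment_mem (haG.ssubset_of_ne hne)
    (mem_closure_keySegment le_rfl))

/-- A bottom descent would have rank 1, and a double descent would give two members of `D` of
consecutive ranks. -/
theorem mem_gammaComplex [M.Finite] [M.Loopless] (h : IsDescentFamily M D) :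
    D ∈ gammaComplex M (maxBuildingSet M) := by
  have hS := isMaxNested_initialFlats (adaptedKey_injective (M := M) (D := D))
  have hDes := h.Des_initialFlats_subset.antisymm h.subset_Des_initialFlats
  refine ⟨_, ⟨hS, fun G ↦ ⟨fun hG ↦ ?_, fun hG ↦ ?_⟩⟩, hDes⟩
  · have h1 := rk_eq_rk_localBot_add_one hS hG.1.1
    rw [(minimal_iff_localBot_eq_empty hS hG.1.1).1 hG.2, rk_empty] at h1
    have := h.two_le_rk G (hDes.subset hG.1)
    omega
  · have hL := (localBot_eq_or hS G).resolve_left fun h0 ↦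
      hG.2.1 ((minimal_iff_localBot_eq_empty hS hG.1.1).2 h0.1)
    exact h.rk_ne _ (hDes.subset (hG.2.2 _ hL.1 (isParent_localBot hS hG.1.1))) G
      (hDes.subset hG.1) (rk_eq_rk_localBot_add_one hS hG.1.1)

end IsDescentFamily

/-- The faces of the `Γ`-complex of the maximal building set. -/
theorem mem_gammaComplex_iff [M.Finite] [M.Loopless] :
    D ∈ gammaComplex M (maxBuildingSet M) ↔ IsDescentFamily M D := by
  refine ⟨?_, fun h ↦ h.mem_gammaComplex⟩
  rintro ⟨S, hS, rfl⟩
  exact isDescentFamily_Des hS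

end AdaptedChain

end BuiltMatroid

namespace BuiltMatroid

/-! ### The vertex set -/

section GammaComplex

variable {α : Type*} {M : Matroid α} {D : Set (Set α)} {F G : Set α}

theorem mem_atoms_iff [M.Finite] (hF : M.IsFlat F) : F ∈ atoms M ↔ rk M F = 1 := by
  rw [atoms, Set.mem_ofPred_eq, ← coe_rk, Nat.cast_eq_one, and_iff_right hF]

variable [LinearOrder M.E]

/-- The right side is the negation of the witness condition for the one-member family `{F}`. It
matters most for the smallest missing `b`: everything before it lies in `F`. -/
theorem mem_orderChain_bot_ground_iff [M.Finite] [M.Loopless] (hF : M.IsFlat F)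
    (hne : F.Nonempty) : F ∈ orderChain M (bot M) M.E ↔
      ∀ b : M.E, (b : α) ∉ F → F ⊆ M.closure {y | y ∈ F ∧ ∃ e : M.E, e = y ∧ e < b} := by
  have := M.ground_finite.to_subtype
  simp only [orderChain, bot_eq_empty, Set.sdiff_empty, Set.empty_union, Set.mem_insert_iff,
    hne.ne_empty, false_or, Set.mem_ofPred_eq]
  constructor
  · rintro ⟨e, -, he⟩ b hb
    have hsub : {x | ∃ y : M.E, (y : α) = x ∧ x ∈ M.E ∧ y ≤ e} ⊆ F :=
      (M.subset_closure _ (by rintro x ⟨_, _, hx, _⟩; exact hx)).trans_eq he.symm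
    refine he.subset.trans (M.closure_subset_closure fun x hx ↦ ⟨hsub hx, ?_⟩)
    obtain ⟨y, hyx, -, hye⟩ := hx
    refine ⟨y, hyx, hye.trans_lt (lt_of_not_ge fun hbe ↦ hb (hsub ⟨b, rfl, b.2, hbe⟩))⟩
  · intro h
    suffices ∃ e : M.E, (∀ y ≤ e, (y : α) ∈ F) ∧
        F ⊆ M.closure {x | ∃ y : M.E, (y : α) = x ∧ x ∈ M.E ∧ y ≤ e} by
      obtain ⟨e, he, hs⟩ := this
      refine ⟨e, e.2, hs.antisymm ((M.closure_subset_closure ?_).trans_eq hF.closure)⟩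
      rintro _ ⟨y, rfl, -, hy⟩
      exact he y hy
    rcases Set.eq_empty_or_nonempty {b : M.E | (b : α) ∉ F} with h0 | hb
    · obtain ⟨x, hx⟩ := hne
      obtain ⟨e, -, hmax⟩ := Set.exists_max_image (Set.univ : Set M.E) id Set.finite_univ
        ⟨⟨x, hF.subset_ground hx⟩, trivial⟩
      refine ⟨e, fun y _ ↦ ?_, fun y hy ↦ ?_⟩
      · by_contra hn
        exact h0.subset (show y ∈ {b : M.E | (b : α) ∉ F} from hn)
      · have hyE := hF.subset_ground hy
        exact M.mem_closure_of_mem' ⟨⟨y, hyE⟩, rfl, hyE, hmax _ trivial⟩ hyE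
    · obtain ⟨b, hbF, hmin⟩ := Set.exists_min_image _ id (Set.toFinite _) hb
      have hsub := h b hbF
      -- The chain index sought is the predecessor of `b`. It exists: otherwise `F` would lie in the
      -- closure of `∅`, which is empty.
      have hlt : {e : M.E | e < b}.Nonempty := by
        rw [Set.nonempty_iff_ne_empty]
        intro h0
        have : {y | y ∈ F ∧ ∃ e : M.E, e = y ∧ e < b} = ∅ := by
          refine Set.eq_empty_of_forall_notMem ?_
          rintro _ ⟨-, e, rfl, he⟩
          exact h0.subset (show e ∈ {e : M.E | e < b} from he)
        rw [this] at hsub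
        exact hne.not_subset_empty (hsub.trans M.loops_eq_empty.subset)
      obtain ⟨e, he, hmax⟩ := Set.exists_max_image _ id (Set.toFinite _) hlt
      refine ⟨e, fun y hy ↦ ?_, hsub.trans (M.closure_subset_closure ?_)⟩
      · by_contra hn
        exact (hy.trans_lt he).not_ge (hmin y hn)
      · rintro _ ⟨-, y, rfl, hy⟩
        exact ⟨y, rfl, y.2, hmax y hy⟩

theorem isDescentFamily_singleton [M.Finite] [M.Loopless]
    (hF : F ∈ gammaVertices M (maxBuildingSet M)) : IsDescentFamily M {F} := by
  obtain ⟨hmem, hn⟩ := hF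
  obtain ⟨hfl, hne⟩ := mem_maxBuildingSet.1 hmem
  rw [Set.mem_union, not_or, mem_orderChain_bot_ground_iff hfl hne, mem_atoms_iff hfl] at hn
  push Not at hn
  obtain ⟨⟨b, hbF, hb⟩, hat⟩ := hn
  have hpos := rk_lt_of_ssubset (by simpa using M.loops_eq_empty ▸ M.isFlat_closure ∅)
    hfl.subset_ground hne.empty_ssubset
  rw [rk_empty] at hpos
  refine ⟨?_, ?_, Set.subsingleton_singleton.isChain, ?_, ?_⟩
  · rintro _ rfl
    exact hfl
  · rintro _ rfl
    omega
  · rintro _ rfl _ rfl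
    omega
  · rintro _ rfl
    refine ⟨b, hbF, fun B hB hs ↦ (hs.ne (Set.mem_singleton_iff.1 hB).symm).elim, fun hs ↦
      hb (hs.trans (M.closure_subset_closure fun y hy ↦ ⟨hy.1, hy.2.resolve_right ?_⟩))⟩
    rintro ⟨A, hA, hAF, -⟩
    exact hAF.ne (Set.mem_singleton_iff.1 hA)

theorem IsDescentFamily.subset_gammaVertices [M.Finite] [M.Loopless] (h : IsDescentFamily M D) :
    D ⊆ gammaVertices M (maxBuildingSet M) := by
  intro G hG
  have hfl := h.isFlat G hG
  have hne := h.nonempty hG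
  refine ⟨mem_maxBuildingSet.2 ⟨hfl, hne⟩, ?_⟩
  rw [Set.mem_union, not_or, mem_orderChain_bot_ground_iff hfl hne, mem_atoms_iff hfl]
  have := h.two_le_rk G hG
  refine ⟨fun hs ↦ ?_, by omega⟩
  obtain ⟨b, hbG, -, hn⟩ := h.exists_notMem G hG
  exact hn ((hs b hbG).trans (M.closure_subset_closure fun y hy ↦ ⟨hy.1, .inl hy.2⟩))

/-! ### The coloring by rank and the size of the largest faces -/

theorem IsDescentFamily.rk_lt [M.Finite] (h : IsDescentFamily M D) (hG : G ∈ D) :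
    rk M G < rk M M.E := by
  obtain ⟨b, hbG, -⟩ := h.exists_notMem G hG
  exact rk_lt_of_ssubset (h.isFlat G hG) subset_rfl
    ⟨(h.isFlat G hG).subset_ground, fun hs ↦ hbG (hs b.2)⟩

/-- Ranks with equal halves differ by at most one; consecutive ranks are excluded, and flats of
equal rank in a chain coincide. -/
theorem IsDescentFamily.injOn [M.Finite] (h : IsDescentFamily M D) :
    Set.InjOn (fun F : Set α ↦ rk M F / 2) D := by
  intro F hF G hG hFG
  have h1 := h.rk_ne F hF G hG
  have h2 := h.rk_ne G hG F hF
  have hrk : rk M F = rk M G := by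
    dsimp only at hFG
    omega
  rcases h.isChain.total hF hG with hs | hs
  · exact eq_of_subset_of_rk_le (h.isFlat F hF) (h.isFlat G hG).subset_ground hs hrk.ge
  · exact (eq_of_subset_of_rk_le (h.isFlat G hG) (h.isFlat F hF).subset_ground hs hrk.le).symm

theorem IsDescentFamily.div_two_mem_Icc [M.Finite] (h : IsDescentFamily M D) (hG : G ∈ D) :
    rk M G / 2 ∈ Finset.Icc 1 ((rk M M.E - 1) / 2) := by
  have h1 := h.two_le_rk G hG
  have h2 := h.rk_lt hG
  rw [Finset.mem_Icc]
  omega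

theorem IsDescentFamily.encard_le [M.Finite] (h : IsDescentFamily M D) :
    D.encard ≤ ((rk M M.E - 1) / 2 : ℕ) := by
  have hmaps : (fun F : Set α ↦ rk M F / 2) '' D ⊆ (Finset.Icc 1 ((rk M M.E - 1) / 2) : Finset ℕ) :=
    Set.image_subset_iff.2 fun G hG ↦ h.div_two_mem_Icc hG
  have := Set.encard_le_encard hmaps
  rwa [h.injOn.encard_image, Set.encard_coe_eq_coe_finsetCard, Nat.card_Icc,
    Nat.add_sub_cancel] at this

/-- The greedy chain of flats, in which each flat is obtained from the preceding one by adding the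
smallest missing element. -/
theorem exists_greedy_chain (M : Matroid α) [M.Finite] [M.Loopless] [LinearOrder M.E] :
    ∃ g : ℕ → Set α, Monotone g ∧ (∀ i, M.IsFlat (g i)) ∧ (∀ i ≤ rk M M.E, rk M (g i) = i) ∧
      ∀ i < rk M M.E, ∃ x : M.E, (x : α) ∉ g i ∧ (x : α) ∈ g (i + 1) ∧
        ∀ y < x, (y : α) ∈ g i := by
  have := M.ground_finite.to_subtype
  have hstep (F : {F // M.IsFlat F}) : ∃ F' : {F // M.IsFlat F}, (F : Set α) ⊆ F' ∧
      (rk M (F : Set α) < rk M M.E → rk M (F' : Set α) = rk M (F : Set α) + 1 ∧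
        ∃ x : M.E, (x : α) ∉ (F : Set α) ∧ (x : α) ∈ (F' : Set α) ∧
          ∀ y < x, (y : α) ∈ (F : Set α)) := by
    obtain ⟨F, hF⟩ := F
    by_cases hr : rk M F < rk M M.E
    · obtain ⟨e, heE, heF⟩ := Set.not_subset.1 fun hs : M.E ⊆ F ↦ hr.not_ge (rk_mono M hs)
      obtain ⟨x, hxF, hmin⟩ := Set.exists_min_image {x : M.E | (x : α) ∉ F} id (Set.toFinite _)
        ⟨⟨e, heE⟩, heF⟩
      have hsub := M.subset_closure _ (Set.insert_subset x.2 hF.subset_ground)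
      refine ⟨⟨_, M.isFlat_closure (insert (x : α) F)⟩, (Set.subset_insert _ _).trans hsub,
        fun _ ↦ ⟨?_, x, hxF, hsub (Set.mem_insert _ _), fun y hy ↦ ?_⟩⟩
      · rw [rk_closure, rk_insert hF x.2 hxF]
      · by_contra hn
        exact hy.not_ge (hmin y hn)
    -- At full rank the step stays put, so it can be iterated indefinitely.
    · exact ⟨⟨F, hF⟩, subset_rfl, fun h ↦ (hr h).elim⟩
  choose next hnext hrk using hstep
  let g : ℕ → {F // M.IsFlat F} := fun n ↦ next^[n] ⟨_, M.isFlat_closure ∅⟩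
  have hg (n : ℕ) : g (n + 1) = next (g n) := Function.iterate_succ_apply' _ _ _
  have hg_rk : ∀ i ≤ rk M M.E, rk M (g i : Set α) = i := by
    intro i
    induction i with
    | zero => exact fun _ ↦ (rk_closure M ∅).trans (rk_empty M)
    | succ i ih =>
      intro hi
      have := ih (by omega)
      rw [hg, (hrk (g i) (by omega)).1, this]
  refine ⟨fun n ↦ g n, monotone_nat_of_le_succ fun n ↦ ?_, fun n ↦ (g n).2, hg_rk, fun i hi ↦ ?_⟩
  · rw [hg]
    exact hnext _
  · beta_reduce
    rw [hg]
    exact (hrk (g i) ((hg_rk i hi.le).trans_lt hi)).2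

/-- Replace the greedy flat of rank `2j + 2` by another flat `G j` of that rank between its
neighbours `g (2j + 1)` and `g (2j + 3)`. The witness is the smallest element missing from `g (2j +
1)`: all smaller elements and all smaller members lie in `g (2j + 1)`, whose rank is too small to
span `G j`. -/
theorem exists_isDescentFamily_encard_eq (M : Matroid α) [M.Finite] [M.Loopless]
    [LinearOrder M.E] :
    ∃ D, IsDescentFamily M D ∧ D.encard = ((rk M M.E - 1) / 2 : ℕ) := by
  obtain ⟨g, hmono, hflat, hrk, hx⟩ := exists_greedy_chain M
  have hex (j : ℕ) (hj : j < (rk M M.E - 1) / 2) : ∃ G, M.IsFlat G ∧ rk M G = 2 * j + 2 ∧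
      g (2 * j + 1) ⊆ G ∧ G ⊆ g (2 * j + 3) ∧ ∃ b : M.E, (b : α) ∉ G ∧
        (b : α) ∈ g (2 * j + 3) ∧ ∀ y < b, (y : α) ∈ g (2 * j + 1) := by
    obtain ⟨b, hb, hb', hbmin⟩ := hx (2 * j + 1) (by omega)
    -- Adjoining `c`, which is outside `g (2j + 2)`, makes the new flat differ from the greedy one.
    -- The bound on `j` gives `2j + 3 ≤ r`.
    obtain ⟨c, hc, hc', -⟩ := hx (2 * j + 2) (by omega)
    have h12 : g (2 * j + 1) ⊆ g (2 * j + 2) := hmono (by omega)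
    have h23 : g (2 * j + 2) ⊆ g (2 * j + 3) := hmono (by omega)
    have hr1 := hrk (2 * j + 1) (by omega)
    have hr2 := hrk (2 * j + 2) (by omega)
    have hsub := M.subset_closure _ (Set.insert_subset c.2 (hflat (2 * j + 1)).subset_ground)
    have hrG : rk M (M.closure (insert (c : α) (g (2 * j + 1)))) = 2 * j + 2 := by
      rw [rk_closure, rk_insert (hflat _) c.2 fun h ↦ hc (h12 h), hr1]
    refine ⟨M.closure (insert (c : α) (g (2 * j + 1))), M.isFlat_closure _, hrG,
      (Set.subset_insert _ _).trans hsub, ?_, b, fun hbG ↦ hc ?_, h23 hb', hbmin⟩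
    · exact (M.closure_subset_closure (Set.insert_subset hc' (h12.trans h23))).trans_eq
        (hflat _).closure
    -- If `b` were in the new flat, then `b` and `c` would span the same flat over `g (2j + 1)`,
    -- forcing `c ∈ g (2j + 2)`.
    · have hcl : M.closure (insert (b : α) (g (2 * j + 1))) =
          M.closure (insert (c : α) (g (2 * j + 1))) :=
        Matroid.closure_insert_congr ⟨hbG, by rwa [(hflat _).closure]⟩
      refine (M.closure_subset_closure (Set.insert_subset hb' h12)).trans_eq (hflat _).closure ?_
      rw [hcl]
      exact hsub (Set.mem_insert _ _)
  choose! G hGfl hGrk hgG hGg b hbG hbg hbmin using hex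
  have hlt {i j : ℕ} (hi : i < (rk M M.E - 1) / 2) (hj : j < (rk M M.E - 1) / 2)
      (hij : i < j) : G i ⊆ g (2 * j + 1) ∧ g (2 * i + 3) ⊆ G j :=
    ⟨(hGg i hi).trans (hmono (by omega)), (hmono (by omega)).trans (hgG j hj)⟩
  have hssub {i j : ℕ} (hi : i < (rk M M.E - 1) / 2) (hj : j < (rk M M.E - 1) / 2)
      (hij : G i ⊂ G j) : i < j := by
    have := rk_lt_of_ssubset (hGfl i hi) (hGfl j hj).subset_ground hij
    rw [hGrk i hi, hGrk j hj] at this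
    omega
  refine ⟨G '' Set.Iio ((rk M M.E - 1) / 2), ⟨?_, ?_, ?_, ?_, ?_⟩, ?_⟩
  · rintro _ ⟨j, hj, rfl⟩
    exact hGfl j hj
  · rintro _ ⟨j, hj, rfl⟩
    rw [hGrk j hj]
    omega
  · rintro _ ⟨i, hi, rfl⟩ _ ⟨j, hj, rfl⟩ hne
    rcases lt_or_gt_of_ne (fun h ↦ hne (congrArg G h) : i ≠ j) with hij | hij
    · exact .inl ((hlt hi hj hij).1.trans (hgG j hj))
    · exact .inr ((hlt hj hi hij).1.trans (hgG i hi))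
  · rintro _ ⟨i, hi, rfl⟩ _ ⟨j, hj, rfl⟩
    rw [hGrk i hi, hGrk j hj]
    omega
  · rintro _ ⟨j, hj, rfl⟩
    refine ⟨b j hj, hbG j hj, ?_, fun hs ↦ ?_⟩
    · rintro _ ⟨i, hi, rfl⟩ hji
      exact (hlt hj hi (hssub hj hi hji)).2 (hbg j hj)
    · have hle := rk_mono M (hs.trans (M.closure_subset_closure (Y := g (2 * j + 1)) ?_))
      · rw [rk_closure, hGrk j hj, hrk _ (by have : j < _ := hj; omega)] at hle
        omega
      · rintro _ ⟨-, ⟨e, rfl, he⟩ | ⟨_, ⟨i, hi, rfl⟩, hij, hy⟩⟩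
        · exact hbmin j hj e he
        · exact (hlt hi hj (hssub hi hj hij)).1 hy
  · have hinj : Set.InjOn G (Set.Iio ((rk M M.E - 1) / 2)) := by
      intro i hi j hj hij
      have := hGrk i hi
      rw [hij, hGrk j hj] at this
      omega
    rw [hinj.encard_image, ← Finset.coe_range, Set.encard_coe_eq_coe_finsetCard,
      Finset.card_range]

end GammaComplex

end BuiltMatroid

theorem mainTheorem3 {α : Type*} (M : Matroid α) [M.Finite] [M.Loopless] [LinearOrder M.E] :
    IsSimplicialComplexOn (BuiltMatroid.gammaVertices M (BuiltMatroid.maxBuildingSet M))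
      (BuiltMatroid.gammaComplex M (BuiltMatroid.maxBuildingSet M)) ∧
    IsBalanced (BuiltMatroid.gammaVertices M (BuiltMatroid.maxBuildingSet M))
      (BuiltMatroid.gammaComplex M (BuiltMatroid.maxBuildingSet M)) ∧
    HasMaxFaceCard (BuiltMatroid.gammaComplex M (BuiltMatroid.maxBuildingSet M))
      ((BuiltMatroid.rk M M.E - 1) / 2) ∧
    (∀ F ∈ BuiltMatroid.gammaVertices M (BuiltMatroid.maxBuildingSet M),
      BuiltMatroid.rk M F / 2 ∈ Finset.Icc 1 ((BuiltMatroid.rk M M.E - 1) / 2)) ∧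
    (∀ D ∈ BuiltMatroid.gammaComplex M (BuiltMatroid.maxBuildingSet M),
      Set.InjOn (fun F : Set α => BuiltMatroid.rk M F / 2) D) := by
  open BuiltMatroid in
  have hcolor : ∀ F ∈ gammaVertices M (maxBuildingSet M),
      rk M F / 2 ∈ Finset.Icc 1 ((rk M M.E - 1) / 2) := fun F hF ↦
    (isDescentFamily_singleton hF).div_two_mem_Icc (Set.mem_singleton F)
  have hinj : ∀ D ∈ gammaComplex M (maxBuildingSet M),
      Set.InjOn (fun F : Set α => rk M F / 2) D := fun D hD ↦ (mem_gammaComplex_iff.1 hD).injOn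
  -- Truncated subtraction gives the value 0 at rank 0, in agreement with the maximum with 0.
  have hcard : HasMaxFaceCard (gammaComplex M (maxBuildingSet M)) ((rk M M.E - 1) / 2) := by
    obtain ⟨D, hD, hDcard⟩ := exists_isDescentFamily_encard_eq M
    refine ⟨⟨D, hD.mem_gammaComplex, hDcard⟩, ?_⟩
    rintro _ ⟨C, hC, rfl⟩
    exact (mem_gammaComplex_iff.1 hC).encard_le
  refine ⟨⟨?_, ?_, ?_, ?_, ?_⟩, ⟨_, hcard, ?_⟩, hcard, hcolor, hinj⟩
  · exact M.ground_finite.finite_subsets.subset fun F hF ↦ hF.1.1.subset_ground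
  · exact hcard.1.imp fun _ ↦ And.left
  · exact fun D hD ↦ (mem_gammaComplex_iff.1 hD).subset_gammaVertices
  · exact fun D hD C hC ↦ ((mem_gammaComplex_iff.1 hD).mono hC).mem_gammaComplex
  · exact fun F hF ↦ (isDescentFamily_singleton hF).mem_gammaComplex
  -- Colors start at 1 while `Fin n` starts at 0, hence the shift; it loses nothing because every
  -- vertex has color at least 1.
  · refine ⟨fun v ↦ ⟨rk M v / 2 - 1, ?_⟩, fun D hD v w hv hw hvw ↦ Subtype.ext ?_⟩
    · have := Finset.mem_Icc.1 (hcolor v v.2)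
      omega
    · have h1 := Finset.mem_Icc.1 (hcolor v v.2)
      have h2 := Finset.mem_Icc.1 (hcolor w w.2)
      have h3 := Fin.mk.inj_iff.1 hvw
      exact hinj D hD hv hw (show rk M v / 2 = rk M w / 2 by omega)
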